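/- Let $\mathbb R^N=\mathbb R^{N_1}\times\cdots\times\mathbb R^{N_n}$ with the Euclidean norm $\|\cdot\|$, and write $x=(x_1,\dots,x_n)$ for the blocks of $x$. Consider the problem $$\min_{x\in\mathbb R^N} F(x):=f(x)+\Psi(x),\qquad \Psi(x)=\sum_{i=1}^n\Psi_i(x_i),$$ where $f:\mathbb R^N\to\mathbb R$ is differentiable and convex, $\Psi_i:\mathbb R^{N_i}\to\mathbb R\cup\{+\infty\}$, $\Psi$ is convex, and there are constants $L_i>0$ such that $\|\nabla_i f(x+h)-\nabla_i f(x)\|\le L_i\|h\|$ for all $x$, all $i$ and all $h$ with $h_j=0$ for $j\ne i$. Assume that the set $X^*$ of optimal solutions is nonempty, let $F^*$ be the optimal value, and put $L_f=\sum_i L_i$. Let $x^0\in\operatorname{dom}F$ (that is, $F(x^0)<+\infty$), $\eta>1$, $\sigma>0$, $0<\underline\theta\le\bar\theta$, an integer $M\ge0$, and $0<p_i<1$ with $\sum_{i=1}^n p_i=1$ be given, and let $\{x^k\}$ be generated by the randomized nonmonotone block proximal gradient method. At iteration $k$, an index $i_k\in\{1,\dots,n\}$ is drawn, independently of the previous draws,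 with $\mathbb P(i_k=i)=p_i$; a number $\theta_k^0\in[\underline\theta,\bar\theta]$ is chosen; for $j=0,1,\dots$ one computes the vector $d$ with $d_i=0$ for $i\neq i_k$ and $$d_{i_k}\in\operatorname*{arg\,min}_s\Big\{\nabla_{i_k}f(x^k)^Ts+\tfrac{\theta_k^0\eta^j}{2}\|s\|^2+\Psi_{i_k}(x^k_{i_k}+s)\Big\},$$ and stops at the first $j$ for which $$F(x^k+d)\le\max_{\max\{k-M,0\}\le t\le k}F(x^t)-\tfrac{\sigma}{2}\|d\|^2;$$ then $x^{k+1}=x^k+d$ for this $d$. The iterate $x^k$ is a function of $\xi_{k-1}=(i_0,\dots,i_{k-1})$, and expectations and probabilities are over the random indices. Assume that $F$ is uniformly continuous on $$\mathcal S=\Big\{x: F(x)\le F(x^0)+\max\Big\{\tfrac n\sigma\,|L_f-\underline\theta|,\,1\Big\}\,(F(x^0)-F^*)\Big\},$$ and that there is a subsequence $\mathcal K$ such that $\{\mathbb E[\operatorname{dist}(x^k,X^*)]\}_{k\in\mathcal K}$ is bounded. Then all the values $F(x^k)$ are finite and integrable, and the following hold. (i) $\lim_{k\to\infty}\mathbb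 E[F(x^k)]=F^*$. (ii) For every $\epsilon>0$ and $\rho\in(0,1)$ there exists $K$ such that $\mathbb P\big(F(x^k)-F^*\le\epsilon\big)\ge1-\rho$ for all $k\ge K$. -/

import Mathlib

open MeasureTheory ProbabilityTheory Filter Topology

noncomputable section

/-- The space `ℝ^N = ℝ^{N₁} × ⋯ × ℝ^{Nₙ}`, with the Euclidean norm. The block `x_i` of a
vector `x` is `x i`. -/
abbrev BlockSpace {n : ℕ} (N : Fin n → ℕ) : Type :=
  PiLp 2 (fun i : Fin n => EuclideanSpace ℝ (Fin (N i)))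

/-- The vector whose block `i` is `s` and whose other blocks are zero. -/
def blockEmbed {n : ℕ} {N : Fin n → ℕ} (i : Fin n) (s : EuclideanSpace ℝ (Fin (N i))) :
    BlockSpace N :=
  WithLp.toLp 2 (Pi.single i s)

/-- The block separable function `Ψ(x) = ∑ i, Ψ_i(x_i)`. -/
def sepSum {n : ℕ} {N : Fin n → ℕ} (Ψ : ∀ i : Fin n, EuclideanSpace ℝ (Fin (N i)) → EReal)
    (x : BlockSpace N) : EReal :=
  ∑ i, Ψ i (x i)

/-- The objective `F = f + Ψ`. -/
def objective {n : ℕ} {N : Fin n → ℕ} (f : BlockSpace N → ℝ)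
    (Ψ : ∀ i : Fin n, EuclideanSpace ℝ (Fin (N i)) → EReal) (x : BlockSpace N) : EReal :=
  (f x : EReal) + sepSum Ψ x

/-- Convexity of an extended-real-valued function that never takes the value `-∞`. -/
def ERealConvex {E : Type*} [AddCommGroup E] [Module ℝ E] (g : E → EReal) : Prop :=
  ∀ x y : E, ∀ a b : ℝ, 0 < a → 0 < b → a + b = 1 →
    g (a • x + b • y) ≤ (a : EReal) * g x + (b : EReal) * g y

/-- The set of (globally) optimal solutions of `min g`. -/
def optSet {E : Type*} (g : E → EReal) : Set E :=
  {x | ∀ y, g x ≤ g y}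

/-- The optimal value of `min g`, as a real number (for problems whose optimal value is
finite). -/
def optVal {E : Type*} (g : E → EReal) : ℝ :=
  (⨅ x, g x).toReal

/-- Block-coordinate-wise Lipschitz continuity of the gradient, with constants `L i`:
`‖∇_i f(x+h) - ∇_i f(x)‖ ≤ L_i ‖h‖` whenever all blocks of `h` other than `i` vanish. -/
def BlockLipschitzGradient {n : ℕ} {N : Fin n → ℕ} (f : BlockSpace N → ℝ) (L : Fin n → ℝ) :
    Prop :=
  ∀ (i : Fin n) (x h : BlockSpace N), (∀ j, j ≠ i → h j = 0) →
    ‖gradient f (x + h) i - gradient f x i‖ ≤ L i * ‖h‖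

/-- The level set
`{x : F(x) ≤ F(x⁰) + max {(n/σ) |L_f - θlo|, 1} (F(x⁰) - F^*)}`, with `L_f = ∑ i, L_i`. -/
def levelSetS {n : ℕ} {N : Fin n → ℕ} (f : BlockSpace N → ℝ)
    (Ψ : ∀ i : Fin n, EuclideanSpace ℝ (Fin (N i)) → EReal) (L : Fin n → ℝ) (σ θlo : ℝ)
    (x0 : BlockSpace N) : Set (BlockSpace N) :=
  {x | objective f Ψ x ≤
    (((objective f Ψ x0).toReal + max ((n : ℝ) / σ * |∑ i, L i - θlo|) 1 *
      ((objective f Ψ x0).toReal - optVal (objective f Ψ)) : ℝ) : EReal)}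

/-- `s` is a minimizer of the proximal subproblem of block `i` at `x` with parameter `θ`:
`min_s ⟨∇_i f(x), s⟩ + (θ/2) ‖s‖² + Ψ_i(x_i + s)`. -/
def IsProxSolution {n : ℕ} {N : Fin n → ℕ} (f : BlockSpace N → ℝ)
    (Ψ : ∀ i : Fin n, EuclideanSpace ℝ (Fin (N i)) → EReal) (x : BlockSpace N) (i : Fin n)
    (θ : ℝ) (s : EuclideanSpace ℝ (Fin (N i))) : Prop :=
  IsMinOn (fun u : EuclideanSpace ℝ (Fin (N i)) =>
    ((inner ℝ (gradient f x i) u + θ / 2 * ‖u‖ ^ 2 : ℝ) : EReal) + Ψ i (x i + u)) Set.univ s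

/-- The acceptance test `F(x + d) ≤ V - (σ/2) ‖d‖²`. -/
def SufficientReduction {n : ℕ} {N : Fin n → ℕ} (f : BlockSpace N → ℝ)
    (Ψ : ∀ i : Fin n, EuclideanSpace ℝ (Fin (N i)) → EReal) (σ : ℝ) (V : EReal)
    (x d : BlockSpace N) : Prop :=
  objective f Ψ (x + d) ≤ V - ((σ / 2 * ‖d‖ ^ 2 : ℝ) : EReal)

/-- One outer iteration of the method from `x` to `x'` when block `i` has been picked and `V` is
the reference value: some initial `θ⁰ ∈ [θlo, θhi]` is chosen, the subproblems with parameters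
`θ⁰ η^j`, `j = 0, 1, …`, are solved with solutions `s j`, and `J` is the first `j` for which the
acceptance test succeeds. -/
def RNBPGStep {n : ℕ} {N : Fin n → ℕ} (f : BlockSpace N → ℝ)
    (Ψ : ∀ i : Fin n, EuclideanSpace ℝ (Fin (N i)) → EReal) (η σ θlo θhi : ℝ) (V : EReal)
    (i : Fin n) (x x' : BlockSpace N) : Prop :=
  ∃ θ0 ∈ Set.Icc θlo θhi, ∃ (J : ℕ) (s : ℕ → EuclideanSpace ℝ (Fin (N i))),
    (∀ j ≤ J, IsProxSolution f Ψ x i (θ0 * η ^ j) (s j)) ∧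
    (∀ j < J, ¬ SufficientReduction f Ψ σ V x (blockEmbed i (s j))) ∧
    SufficientReduction f Ψ σ V x (blockEmbed i (s J)) ∧
    x' = x + blockEmbed i (s J)

/-- `x⁰, x¹, …` is generated by the randomized nonmonotone block proximal gradient method from
the starting point `x0` and the random block indices `i_0, i_1, …`. -/
structure IsRNBPG {n : ℕ} {N : Fin n → ℕ} {Ω : Type*} (f : BlockSpace N → ℝ)
    (Ψ : ∀ i : Fin n, EuclideanSpace ℝ (Fin (N i)) → EReal) (η σ θlo θhi : ℝ) (M : ℕ)
    (x0 : BlockSpace N) (idx : ℕ → Ω → Fin n) (x : ℕ → Ω → BlockSpace N) : Prop where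
  init : ∀ ω, x 0 ω = x0
  /-- The iterate `x^k` is determined by `ξ_{k-1} = (i_0, …, i_{k-1})`. -/
  determined : ∀ k ω ω', (∀ t < k, idx t ω = idx t ω') → x k ω = x k ω'
  /-- The reference value is `max {F(x^t) : max (k - M) 0 ≤ t ≤ k}`. -/
  step : ∀ k ω, RNBPGStep f Ψ η σ θlo θhi
    ((Finset.Icc (k - M) k).sup fun t => objective f Ψ (x t ω)) (idx k ω) (x k ω) (x (k + 1) ω)

end

/-!
Along every path, acceptance makes `F(x^{k+1}) ≤ V_k - (σ/2) ‖x^{k+1} - x^k‖²`, where `V_k` is the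
maximum of the last `M + 1` values. Hence `V_k` decreases to a limit `v`. Late in the path, a value
close to `v` forces the preceding step to be short, and by uniform continuity the preceding value
is then also close to `v`; going back through the window, all of `F(x^k)` tends to
`v` and the steps tend to `0` (`nonmonotone_descent`). The iterates stay in `{F ≤ F(x⁰)}`, so
values and steps are bounded, and dominated convergence turns this into statements about expectations.

It remains to see that `E[v] = F*`. Fix `k` and let `y_i` be the iterate that would follow `x^k`
if block `i` were drawn. The optimality conditions of the proximal subproblems, convexity of `f`
and `Ψ`, and the descent inequality along a single block give, for every minimizer `z`
(`optimality_gap_le`),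
`F(x^k) - F* ≤ ∑ i, (|F(x^k) - F(y_i)| + (L_i/2) ‖y_i - x^k‖²) + Θ (∑ i, ‖y_i - x^k‖) ‖x^k - z‖`,
where `Θ` bounds the accepted proximal parameters (`RNBPGStep.exists_prox`). Since `i_k` is
independent of the past, `p_i E[h(x^k, y_i)] ≤ E[h(x^k, x^{k+1})]` for nonnegative `h`
(`mul_integral_le_of_determined`), so everything multiplying or preceding the distance tends to `0`
in mean. The distance itself is bounded only in mean and along a subsequence, but the gap is at
most `C = F(x⁰) - F*`, so a bound `a + b · dist` may be replaced by `a + R b + (C/R) dist` for any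
`R > 0` (`le_add_mul_add_div_mul`). Taking the limit along the subsequence and then `R → ∞` gives
`E[F(x^k)] → F*`; Markov's inequality gives the statement in probability.
-/

/-! ### Extended-real arithmetic of the block separable objective -/

section Objective

variable {n : ℕ} {N : Fin n → ℕ} {f : BlockSpace N → ℝ}
  {Ψ : ∀ i : Fin n, EuclideanSpace ℝ (Fin (N i)) → EReal}

lemma blockEmbed_apply_same (i : Fin n) (s : EuclideanSpace ℝ (Fin (N i))) :
    (blockEmbed i s : BlockSpace N) i = s := by
  simp [blockEmbed]

lemma blockEmbed_apply_ne {i j : Fin n} (h : j ≠ i) (s : EuclideanSpace ℝ (Fin (N i))) :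
    (blockEmbed i s : BlockSpace N) j = 0 := by
  simp [blockEmbed, Pi.single_eq_of_ne h]

lemma norm_blockEmbed (i : Fin n) (s : EuclideanSpace ℝ (Fin (N i))) :
    ‖(blockEmbed i s : BlockSpace N)‖ = ‖s‖ :=
  PiLp.norm_single 2 (fun i : Fin n => EuclideanSpace ℝ (Fin (N i))) i s

lemma inner_blockEmbed (i : Fin n) (g : BlockSpace N) (s : EuclideanSpace ℝ (Fin (N i))) :
    inner ℝ g (blockEmbed i s) = inner ℝ (g i) s := by
  rw [PiLp.inner_apply, Finset.sum_eq_single i]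
  · rw [blockEmbed_apply_same]
  · intro j _ hj
    rw [blockEmbed_apply_ne hj, inner_zero_right]
  · simp

lemma smul_blockEmbed (i : Fin n) (t : ℝ) (s : EuclideanSpace ℝ (Fin (N i))) :
    (t • blockEmbed i s : BlockSpace N) = blockEmbed i (t • s) := by
  ext1 j
  by_cases hj : j = i
  · subst hj
    rw [PiLp.smul_apply, blockEmbed_apply_same, blockEmbed_apply_same]
  · rw [PiLp.smul_apply, blockEmbed_apply_ne hj, blockEmbed_apply_ne hj, smul_zero]

lemma blockEmbed_add (i : Fin n) (s u : EuclideanSpace ℝ (Fin (N i))) :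
    (blockEmbed i (s + u) : BlockSpace N) = blockEmbed i s + blockEmbed i u := by
  ext1 j
  by_cases hj : j = i
  · subst hj
    simp only [PiLp.add_apply, blockEmbed_apply_same]
  · simp only [PiLp.add_apply, blockEmbed_apply_ne hj, add_zero]

lemma ereal_coe_sum {ι : Type*} (s : Finset ι) (g : ι → ℝ) :
    ((∑ i ∈ s, g i : ℝ) : EReal) = ∑ i ∈ s, (g i : EReal) := by
  classical
  induction s using Finset.induction_on with
  | empty => simp
  | insert a s ha ih => rw [Finset.sum_insert ha, Finset.sum_insert ha, EReal.coe_add, ih]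

lemma ereal_sum_ne_bot {ι : Type*} (s : Finset ι) {g : ι → EReal} (hg : ∀ i, g i ≠ ⊥) :
    ∑ i ∈ s, g i ≠ ⊥ := by
  classical
  induction s using Finset.induction_on with
  | empty => simp
  | insert a s ha ih =>
    rw [Finset.sum_insert ha]
    exact EReal.add_ne_bot_iff.2 ⟨hg a, ih⟩

lemma sepSum_eq_coe (hb : ∀ i u, Ψ i u ≠ ⊥) {x : BlockSpace N} (h : ∀ i, Ψ i (x i) ≠ ⊤) :
    sepSum Ψ x = ((∑ i, (Ψ i (x i)).toReal : ℝ) : EReal) := by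
  rw [ereal_coe_sum]
  exact Finset.sum_congr rfl fun i _ => (EReal.coe_toReal (h i) (hb i _)).symm

lemma sepSum_ne_top_iff (hb : ∀ i u, Ψ i u ≠ ⊥) {x : BlockSpace N} :
    sepSum Ψ x ≠ ⊤ ↔ ∀ i, Ψ i (x i) ≠ ⊤ := by
  constructor
  · intro h i hi
    apply h
    rw [sepSum, ← Finset.add_sum_erase _ _ (Finset.mem_univ i), hi]
    exact EReal.top_add_of_ne_bot (ereal_sum_ne_bot _ fun j => hb j _)
  · intro h
    rw [sepSum_eq_coe hb h]
    exact EReal.coe_ne_top _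

lemma objective_ne_bot (hb : ∀ i u, Ψ i u ≠ ⊥) (x : BlockSpace N) : objective f Ψ x ≠ ⊥ :=
  EReal.add_ne_bot_iff.2 ⟨EReal.coe_ne_bot _, ereal_sum_ne_bot _ fun i => hb i _⟩

lemma objective_ne_top_iff (hb : ∀ i u, Ψ i u ≠ ⊥) {x : BlockSpace N} :
    objective f Ψ x ≠ ⊤ ↔ ∀ i, Ψ i (x i) ≠ ⊤ := by
  rw [← sepSum_ne_top_iff hb]
  constructor
  · intro h h'
    exact h (by rw [objective, h', EReal.coe_add_top])
  · intro h
    exact EReal.add_ne_top (EReal.coe_ne_top _) h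

lemma objective_eq_coe (hb : ∀ i u, Ψ i u ≠ ⊥) {x : BlockSpace N} (h : ∀ i, Ψ i (x i) ≠ ⊤) :
    objective f Ψ x = ((f x + ∑ i, (Ψ i (x i)).toReal : ℝ) : EReal) := by
  rw [objective, sepSum_eq_coe hb h, EReal.coe_add]

lemma toReal_objective (hb : ∀ i u, Ψ i u ≠ ⊥) {x : BlockSpace N} (h : objective f Ψ x ≠ ⊤) :
    (objective f Ψ x).toReal = f x + ∑ i, (Ψ i (x i)).toReal := by
  rw [objective_eq_coe hb ((objective_ne_top_iff hb).1 h), EReal.toReal_coe]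

/-- Moving inside block `i` changes only the `i`-th term of the separable sum. -/
lemma sum_toReal_add_blockEmbed (x : BlockSpace N) (i : Fin n)
    (s : EuclideanSpace ℝ (Fin (N i))) :
    ∑ j, (Ψ j ((x + blockEmbed i s) j)).toReal
      = ∑ j, (Ψ j (x j)).toReal + ((Ψ i (x i + s)).toReal - (Ψ i (x i)).toReal) := by
  rw [← Finset.add_sum_erase _ _ (Finset.mem_univ i),
    ← Finset.add_sum_erase _ (fun j => (Ψ j (x j)).toReal) (Finset.mem_univ i)]
  have : ∑ j ∈ Finset.univ.erase i, (Ψ j ((x + blockEmbed i s) j)).toReal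
      = ∑ j ∈ Finset.univ.erase i, (Ψ j (x j)).toReal := by
    refine Finset.sum_congr rfl fun j hj => ?_
    rw [PiLp.add_apply, blockEmbed_apply_ne (Finset.ne_of_mem_erase hj), add_zero]
  rw [this, PiLp.add_apply, blockEmbed_apply_same]
  ring

lemma ne_top_add_blockEmbed {x : BlockSpace N} (h : ∀ j, Ψ j (x j) ≠ ⊤) {i : Fin n}
    {s : EuclideanSpace ℝ (Fin (N i))} (hs : Ψ i (x i + s) ≠ ⊤) (j : Fin n) :
    Ψ j ((x + blockEmbed i s) j) ≠ ⊤ := by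
  by_cases hj : j = i
  · subst hj
    rwa [PiLp.add_apply, blockEmbed_apply_same]
  · rw [PiLp.add_apply, blockEmbed_apply_ne hj, add_zero]
    exact h j

/-- Convexity of the separable sum gives convexity of each of its terms, on the domain. -/
lemma toReal_block_convex (hb : ∀ i u, Ψ i u ≠ ⊥) (hΨ : ERealConvex (sepSum Ψ))
    {x : BlockSpace N} (hx : ∀ j, Ψ j (x j) ≠ ⊤) {i : Fin n}
    {s u : EuclideanSpace ℝ (Fin (N i))} (hs : Ψ i (x i + s) ≠ ⊤) (hu : Ψ i (x i + u) ≠ ⊤)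
    {a b : ℝ} (ha : 0 < a) (hb' : 0 < b) (hab : a + b = 1) :
    Ψ i (x i + (a • s + b • u)) ≠ ⊤ ∧ (Ψ i (x i + (a • s + b • u))).toReal
      ≤ a * (Ψ i (x i + s)).toReal + b * (Ψ i (x i + u)).toReal := by
  have h := hΨ (x + blockEmbed i s) (x + blockEmbed i u) a b ha hb' hab
  have e : a • (x + blockEmbed i s) + b • (x + blockEmbed i u)
      = x + blockEmbed i (a • s + b • u) := by
    rw [blockEmbed_add, ← smul_blockEmbed, ← smul_blockEmbed, smul_add, smul_add]
    have : x = a • x + b • x := by rw [← add_smul, hab, one_smul]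
    nth_rewrite 3 [this]
    abel
  rw [e, sepSum_eq_coe hb (ne_top_add_blockEmbed hx hs),
    sepSum_eq_coe hb (ne_top_add_blockEmbed hx hu), ← EReal.coe_mul, ← EReal.coe_mul,
    ← EReal.coe_add] at h
  have hfin : ∀ j, Ψ j ((x + blockEmbed i (a • s + b • u)) j) ≠ ⊤ :=
    (sepSum_ne_top_iff hb).1 (ne_top_of_le_ne_top (EReal.coe_ne_top _) h)
  rw [sepSum_eq_coe hb hfin, EReal.coe_le_coe_iff, sum_toReal_add_blockEmbed,
    sum_toReal_add_blockEmbed, sum_toReal_add_blockEmbed] at h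
  refine ⟨?_, ?_⟩
  · have := hfin i
    rwa [PiLp.add_apply, blockEmbed_apply_same] at this
  · have hb1 : b = 1 - a := by linarith
    subst hb1
    linarith

lemma optVal_eq {x : BlockSpace N} (hx : x ∈ optSet (objective f Ψ)) :
    optVal (objective f Ψ) = (objective f Ψ x).toReal := by
  rw [optVal, le_antisymm (iInf_le _ x) (le_iInf hx)]

lemma optVal_le (hb : ∀ i u, Ψ i u ≠ ⊥) (hopt : (optSet (objective f Ψ)).Nonempty)
    {x : BlockSpace N} (hx : objective f Ψ x ≠ ⊤) :
    optVal (objective f Ψ) ≤ (objective f Ψ x).toReal := by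
  obtain ⟨z, hz⟩ := hopt
  rw [optVal_eq hz]
  exact EReal.toReal_le_toReal (hz x) (objective_ne_bot hb z) hx

end Objective

/-! ### Smooth convex functions -/

section Smooth

variable {n : ℕ} {N : Fin n → ℕ} {f : BlockSpace N → ℝ} {L : Fin n → ℝ}

lemma hasDerivAt_comp_line {E : Type*} [NormedAddCommGroup E] [InnerProductSpace ℝ E]
    [CompleteSpace E] {f : E → ℝ} (hf : Differentiable ℝ f) (x d : E) (t : ℝ) :
    HasDerivAt (fun t : ℝ => f (x + t • d)) (inner ℝ (gradient f (x + t • d)) d) t := by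
  have h1 : HasDerivAt (fun t : ℝ => x + t • d) d t := by
    simpa using ((hasDerivAt_id t).smul_const d).const_add x
  have h2 := (hf (x + t • d)).hasGradientAt.hasFDerivAt.comp_hasDerivAt t h1
  rw [InnerProductSpace.toDual_apply_apply] at h2
  exact h2

lemma ConvexOn.add_inner_gradient_le {E : Type*} [NormedAddCommGroup E] [InnerProductSpace ℝ E]
    [CompleteSpace E] {f : E → ℝ} (hc : ConvexOn ℝ Set.univ f) (hf : Differentiable ℝ f)
    (x y : E) : f x + inner ℝ (gradient f x) (y - x) ≤ f y := by
  have hg : ConvexOn ℝ Set.univ (fun t : ℝ => f (x + t • (y - x))) := by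
    refine ⟨convex_univ, fun s _ t _ a b ha hb hab => ?_⟩
    have := hc.2 (Set.mem_univ (x + s • (y - x))) (Set.mem_univ (x + t • (y - x))) ha hb hab
    convert this using 2
    have hx : x = a • x + b • x := by rw [← add_smul, hab, one_smul]
    nth_rewrite 1 [hx]
    simp only [smul_eq_mul, smul_add, smul_smul, add_smul]
    abel
  have h := hg.le_slope_of_hasDerivAt (Set.mem_univ 0) (Set.mem_univ 1) one_pos
    (hasDerivAt_comp_line hf x (y - x) 0)
  rw [slope_def_field, zero_smul, add_zero, one_smul, add_sub_cancel, sub_zero, div_one] at h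
  linarith

/-- The descent inequality along a single block. -/
lemma BlockLipschitzGradient.descent (hLip : BlockLipschitzGradient f L)
    (hf : Differentiable ℝ f) (x : BlockSpace N) (i : Fin n) (s : EuclideanSpace ℝ (Fin (N i))) :
    f (x + blockEmbed i s) ≤ f x + inner ℝ (gradient f x i) s + L i / 2 * ‖s‖ ^ 2 := by
  set g : ℝ → ℝ := fun t => f (x + t • blockEmbed i s) - t * inner ℝ (gradient f x i) s
    - L i / 2 * ‖s‖ ^ 2 * t ^ 2 with hg
  have hd : ∀ t, HasDerivAt g (inner ℝ (gradient f (x + t • blockEmbed i s)) (blockEmbed i s)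
      - inner ℝ (gradient f x i) s - L i / 2 * ‖s‖ ^ 2 * (2 * t)) t := by
    intro t
    have h1 := hasDerivAt_comp_line hf x (blockEmbed i s) t
    have h2 := (hasDerivAt_id t).mul_const (inner ℝ (gradient f x i) s)
    have h3 := (hasDerivAt_pow 2 t).const_mul (L i / 2 * ‖s‖ ^ 2)
    refine ((h1.sub h2).sub h3).congr_deriv ?_
    norm_num
  have hanti : AntitoneOn g (Set.Icc 0 1) := by
    refine antitoneOn_of_deriv_nonpos (convex_Icc 0 1)
      (fun t _ => (hd t).continuousAt.continuousWithinAt)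
      (fun t _ => (hd t).differentiableAt.differentiableWithinAt) fun t ht => ?_
    rw [interior_Icc] at ht
    rw [(hd t).deriv, inner_blockEmbed, ← inner_sub_left]
    have h1 := hLip i x (t • blockEmbed i s) fun j hj => by
      rw [PiLp.smul_apply, blockEmbed_apply_ne hj, smul_zero]
    rw [norm_smul, norm_blockEmbed, Real.norm_of_nonneg ht.1.le] at h1
    have h2 := real_inner_le_norm (gradient f (x + t • blockEmbed i s) i - gradient f x i) s
    have h3 := mul_le_mul_of_nonneg_right h1 (norm_nonneg s)
    nlinarith
  have := hanti (Set.left_mem_Icc.2 zero_le_one) (Set.right_mem_Icc.2 zero_le_one) zero_le_one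
  simp [hg] at this
  linarith

end Smooth

/-! ### The proximal subproblem -/

section Prox

variable {n : ℕ} {N : Fin n → ℕ} {f : BlockSpace N → ℝ}
  {Ψ : ∀ i : Fin n, EuclideanSpace ℝ (Fin (N i)) → EReal} {L : Fin n → ℝ}
  {x : BlockSpace N} {i : Fin n} {θ : ℝ} {s : EuclideanSpace ℝ (Fin (N i))}

lemma IsProxSolution.ne_top (h : IsProxSolution f Ψ x i θ s) (hx : Ψ i (x i) ≠ ⊤) :
    Ψ i (x i + s) ≠ ⊤ := by
  intro ht
  have h0 := h (Set.mem_univ 0)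
  simp only [Set.mem_ofPred_eq, ht, EReal.coe_add_top, top_le_iff] at h0
  exact EReal.add_ne_top (EReal.coe_ne_top _) (by simpa using hx) h0

lemma IsProxSolution.le (h : IsProxSolution f Ψ x i θ s) (hb : ∀ i u, Ψ i u ≠ ⊥)
    (hx : Ψ i (x i) ≠ ⊤) {u : EuclideanSpace ℝ (Fin (N i))} (hu : Ψ i (x i + u) ≠ ⊤) :
    inner ℝ (gradient f x i) s + θ / 2 * ‖s‖ ^ 2 + (Ψ i (x i + s)).toReal
      ≤ inner ℝ (gradient f x i) u + θ / 2 * ‖u‖ ^ 2 + (Ψ i (x i + u)).toReal := by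
  have h0 := h (Set.mem_univ u)
  simp only [Set.mem_ofPred_eq] at h0
  rw [← EReal.coe_toReal (h.ne_top hx) (hb _ _), ← EReal.coe_toReal hu (hb _ _),
    ← EReal.coe_add, ← EReal.coe_add, EReal.coe_le_coe_iff] at h0
  exact h0

/-- The first-order optimality condition of the proximal subproblem, as a variational
inequality. -/
lemma IsProxSolution.variational (h : IsProxSolution f Ψ x i θ s) (hb : ∀ i u, Ψ i u ≠ ⊥)
    (hΨ : ERealConvex (sepSum Ψ)) (hx : ∀ j, Ψ j (x j) ≠ ⊤)
    {u : EuclideanSpace ℝ (Fin (N i))} (hu : Ψ i (x i + u) ≠ ⊤) :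
    0 ≤ inner ℝ (gradient f x i) (u - s) + θ * inner ℝ s (u - s)
      + ((Ψ i (x i + u)).toReal - (Ψ i (x i + s)).toReal) := by
  set A := inner ℝ (gradient f x i) (u - s) + θ * inner ℝ s (u - s)
      + ((Ψ i (x i + u)).toReal - (Ψ i (x i + s)).toReal) with hA
  -- Compare `s` with the point `(1 - t) s + t u` and let `t` tend to `0`.
  have key : ∀ t ∈ Set.Ioo (0 : ℝ) 1, 0 ≤ A + t * (θ / 2 * ‖u - s‖ ^ 2) := by
    intro t ht
    obtain ⟨h1, h2⟩ := toReal_block_convex hb hΨ hx (h.ne_top (hx i)) hu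
      (sub_pos.2 ht.2) ht.1 (by ring : (1 - t) + t = 1)
    have e : (1 - t) • s + t • u = s + t • (u - s) := by
      rw [sub_smul, one_smul, smul_sub]; abel
    rw [e] at h1 h2
    have h3 := h.le hb (hx i) h1
    rw [inner_add_right, inner_smul_right, norm_add_sq_real, inner_smul_right, norm_smul,
      Real.norm_of_nonneg ht.1.le] at h3
    have h4 : 0 ≤ t * (A + t * (θ / 2 * ‖u - s‖ ^ 2)) := by
      rw [hA]; nlinarith
    exact nonneg_of_mul_nonneg_right h4 ht.1
  have hlim : Tendsto (fun t : ℝ => A + t * (θ / 2 * ‖u - s‖ ^ 2)) (𝓝[>] 0) (𝓝 A) := by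
    have : Continuous fun t : ℝ => A + t * (θ / 2 * ‖u - s‖ ^ 2) := by fun_prop
    simpa using (this.tendsto 0).mono_left nhdsWithin_le_nhds
  exact ge_of_tendsto hlim (eventually_of_mem (Ioo_mem_nhdsGT one_pos) key)

/-- A proximal step with parameter `θ` decreases the objective by at least
`(θ - L_i) / 2 * ‖s‖ ^ 2`; in particular the acceptance test succeeds once `θ ≥ L_i + σ`. -/
lemma IsProxSolution.objective_le (h : IsProxSolution f Ψ x i θ s) (hb : ∀ i u, Ψ i u ≠ ⊥)
    (hf : Differentiable ℝ f) (hLip : BlockLipschitzGradient f L)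
    (hx : objective f Ψ x ≠ ⊤) :
    objective f Ψ (x + blockEmbed i s)
      ≤ (((objective f Ψ x).toReal - (θ - L i) / 2 * ‖s‖ ^ 2 : ℝ) : EReal) := by
  have hx' := (objective_ne_top_iff hb).1 hx
  have h1 := h.le hb (hx' i) (u := 0) (by simpa using hx' i)
  have h2 := hLip.descent hf x i s
  rw [objective_eq_coe hb (ne_top_add_blockEmbed hx' (h.ne_top (hx' i))),
    EReal.coe_le_coe_iff, toReal_objective hb hx, sum_toReal_add_blockEmbed]
  simp at h1
  linarith

/-- The error bound behind the convergence proof: the optimality gap at `x` is controlled by the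
sizes of the blockwise proximal steps and the objective changes they cause. -/
lemma optimality_gap_le (hb : ∀ i u, Ψ i u ≠ ⊥) (hf : Differentiable ℝ f)
    (hfc : ConvexOn ℝ Set.univ f) (hLip : BlockLipschitzGradient f L)
    (hΨ : ERealConvex (sepSum Ψ)) (hx : objective f Ψ x ≠ ⊤) {Θ : ℝ} {θ : Fin n → ℝ}
    (hθ0 : ∀ i, 0 ≤ θ i) (hθ : ∀ i, θ i ≤ Θ) {s : ∀ i, EuclideanSpace ℝ (Fin (N i))}
    (hs : ∀ i, IsProxSolution f Ψ x i (θ i) (s i)) {z : BlockSpace N}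
    (hz : z ∈ optSet (objective f Ψ)) :
    (objective f Ψ x).toReal - optVal (objective f Ψ)
      ≤ ∑ i, (|(objective f Ψ x).toReal - (objective f Ψ (x + blockEmbed i (s i))).toReal|
          + L i / 2 * ‖s i‖ ^ 2) + (Θ * ∑ i, ‖s i‖) * dist x z := by
  have hx' := (objective_ne_top_iff hb).1 hx
  have hzt : objective f Ψ z ≠ ⊤ := ne_top_of_le_ne_top hx (hz x)
  have hz' := (objective_ne_top_iff hb).1 hzt
  have hgrad := hfc.add_inner_gradient_le hf x z
  rw [PiLp.inner_apply] at hgrad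
  -- The contribution of each block.
  have hi : ∀ i, (Ψ i (x i)).toReal - (Ψ i (z i)).toReal - inner ℝ (gradient f x i) ((z - x) i)
      ≤ (|(objective f Ψ x).toReal - (objective f Ψ (x + blockEmbed i (s i))).toReal|
          + L i / 2 * ‖s i‖ ^ 2) + Θ * ‖s i‖ * dist x z := by
    intro i
    have hu : x i + (z - x) i = z i := by rw [PiLp.sub_apply]; abel
    have hv := (hs i).variational hb hΨ hx' (u := (z - x) i) (by rw [hu]; exact hz' i)
    rw [hu, inner_sub_right, inner_sub_right, real_inner_self_eq_norm_sq] at hv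
    have hd := hLip.descent hf x i (s i)
    have hF : objective f Ψ (x + blockEmbed i (s i)) ≠ ⊤ :=
      (objective_ne_top_iff hb).2 (ne_top_add_blockEmbed hx' ((hs i).ne_top (hx' i)))
    have habs := le_abs_self
      ((objective f Ψ x).toReal - (objective f Ψ (x + blockEmbed i (s i))).toReal)
    nth_rewrite 1 [toReal_objective hb hx, toReal_objective hb hF,
      sum_toReal_add_blockEmbed] at habs
    have hc : inner ℝ (s i) ((z - x) i) ≤ ‖s i‖ * dist x z := by
      refine (real_inner_le_norm _ _).trans ?_
      rw [dist_comm, dist_eq_norm]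
      exact mul_le_mul_of_nonneg_left (PiLp.norm_apply_le _ _) (norm_nonneg _)
    have h1 : θ i * inner ℝ (s i) ((z - x) i) ≤ Θ * ‖s i‖ * dist x z := by
      calc θ i * inner ℝ (s i) ((z - x) i) ≤ θ i * (‖s i‖ * dist x z) :=
            mul_le_mul_of_nonneg_left hc (hθ0 i)
        _ ≤ Θ * (‖s i‖ * dist x z) := mul_le_mul_of_nonneg_right (hθ i) (by positivity)
        _ = _ := by ring
    have h2 : 0 ≤ θ i * ‖s i‖ ^ 2 := mul_nonneg (hθ0 i) (sq_nonneg _)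
    linarith
  have hsum := Finset.sum_le_sum fun i (_ : i ∈ Finset.univ) => hi i
  rw [Finset.sum_add_distrib (f := fun i => |(objective f Ψ x).toReal
    - (objective f Ψ (x + blockEmbed i (s i))).toReal| + L i / 2 * ‖s i‖ ^ 2),
    ← Finset.sum_mul, ← Finset.mul_sum, Finset.sum_sub_distrib, Finset.sum_sub_distrib] at hsum
  rw [optVal_eq hz, toReal_objective hb hzt]
  nth_rewrite 1 [toReal_objective hb hx]
  linarith

/-- What one outer iteration guarantees: the accepted displacement is a proximal step whose
parameter is bounded independently of the iterate, because backtracking stops as soon as the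
parameter exceeds `L_i + σ`. -/
lemma RNBPGStep.exists_prox {η σ θlo θhi : ℝ} {V : EReal} {x' : BlockSpace N}
    (h : RNBPGStep f Ψ η σ θlo θhi V i x x') (hb : ∀ i u, Ψ i u ≠ ⊥)
    (hf : Differentiable ℝ f) (hLip : BlockLipschitzGradient f L) (hL : ∀ i, 0 < L i)
    (hη : 1 < η) (hθlo : 0 < θlo)
    (hx : objective f Ψ x ≠ ⊤) (hV : objective f Ψ x ≤ V) :
    ∃ θ s, 0 ≤ θ ∧ θ ≤ max θhi (η * (∑ i, L i + σ)) ∧ IsProxSolution f Ψ x i θ s ∧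
      x' = x + blockEmbed i s ∧ SufficientReduction f Ψ σ V x (blockEmbed i s) := by
  obtain ⟨θ0, hθ0, J, s, hs, hrej, hacc, rfl⟩ := h
  have hθ0' : 0 < θ0 := hθlo.trans_le hθ0.1
  have hη0 : 0 < η := one_pos.trans hη
  refine ⟨θ0 * η ^ J, s J, by positivity, ?_, hs J le_rfl, rfl, hacc⟩
  cases J with
  | zero => simpa using Or.inl hθ0.2
  | succ m =>
    refine le_max_of_le_right ?_
    by_contra! hlt
    refine hrej m (Nat.lt_succ_self m) ?_
    have h1 := (hs m (Nat.le_succ m)).objective_le hb hf hLip hx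
    have h2 : ∑ i, L i + σ < θ0 * η ^ m := by
      rw [pow_succ] at hlt
      exact lt_of_mul_lt_mul_left (by linarith) hη0.le
    have h3 : L i ≤ ∑ j, L j :=
      Finset.single_le_sum (fun j _ => (hL j).le) (Finset.mem_univ i)
    have h4 : σ / 2 * ‖s m‖ ^ 2 ≤ (θ0 * η ^ m - L i) / 2 * ‖s m‖ ^ 2 :=
      mul_le_mul_of_nonneg_right (by linarith) (sq_nonneg _)
    rw [SufficientReduction, norm_blockEmbed]
    calc _ ≤ _ := h1
      _ ≤ (((objective f Ψ x).toReal - σ / 2 * ‖s m‖ ^ 2 : ℝ) : EReal) := by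
        exact_mod_cast sub_le_sub_left h4 _
      _ = objective f Ψ x - ((σ / 2 * ‖s m‖ ^ 2 : ℝ) : EReal) := by
        rw [EReal.coe_sub, EReal.coe_toReal hx (objective_ne_bot hb x)]
      _ ≤ _ := EReal.sub_le_sub hV le_rfl

end Prox

/-! ### Nonmonotone descent sequences -/

/-- A sequence bounded below whose decrease is measured against the maximum over a sliding window
converges, and the steps tend to zero, provided small steps change the values little. -/
lemma nonmonotone_descent {F d : ℕ → ℝ} {M : ℕ} {σ c : ℝ} (hσ : 0 < σ) (hc : ∀ k, c ≤ F k)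
    (hd : ∀ k, 0 ≤ d k)
    (hdesc : ∀ k, ∃ t ∈ Finset.Icc (k - M) k, F (k + 1) ≤ F t - σ / 2 * d k ^ 2)
    (hunif : ∀ ε > 0, ∃ δ > 0, ∀ k, d k < δ → |F (k + 1) - F k| < ε) :
    (∃ v, Tendsto F atTop (𝓝 v)) ∧ Tendsto d atTop (𝓝 0) := by
  have hne : ∀ k, (Finset.Icc (k - M) k).Nonempty := fun k => ⟨k, by simp⟩
  set V : ℕ → ℝ := fun k => (Finset.Icc (k - M) k).sup' (hne k) F with hV
  have hFV : ∀ k, F k ≤ V k := fun k => Finset.le_sup' F (by simp)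
  have hVd : ∀ k, F (k + 1) ≤ V k - σ / 2 * d k ^ 2 := by
    intro k
    obtain ⟨t, ht, h⟩ := hdesc k
    have := Finset.le_sup' F ht
    linarith
  have hanti : Antitone V := by
    refine antitone_nat_of_succ_le fun k => Finset.sup'_le _ _ fun t ht => ?_
    rw [Finset.mem_Icc] at ht
    rcases eq_or_lt_of_le ht.2 with h | h
    · have := hVd k
      have : 0 ≤ σ / 2 * d k ^ 2 := by positivity
      rw [h]; linarith
    · exact Finset.le_sup' F (Finset.mem_Icc.2 ⟨by omega, by omega⟩)
  have hbdd : BddBelow (Set.range V) := ⟨c, by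
    rintro _ ⟨k, rfl⟩; exact (hc k).trans (hFV k)⟩
  set v := ⨅ k, V k with hv
  have hVv : Tendsto V atTop (𝓝 v) := tendsto_atTop_ciInf hanti hbdd
  have hvV : ∀ k, v ≤ V k := fun k => ciInf_le hbdd k
  -- Being close to the limit propagates backwards by one step.
  have back : ∀ ε > 0, ∃ ε' > 0, ∃ K, ∀ k ≥ K, v - ε' ≤ F (k + 1) → v - ε ≤ F k := by
    intro ε hε
    obtain ⟨δ, hδ, hδ'⟩ := hunif (ε / 2) (by positivity)
    have hpos : 0 < min (ε / 2) (σ * δ ^ 2 / 8) := by positivity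
    refine ⟨_, hpos, ?_⟩
    obtain ⟨K, hK⟩ := eventually_atTop.1
      (hVv.eventually (gt_mem_nhds (lt_add_of_pos_right v hpos)))
    refine ⟨K, fun k hk h => ?_⟩
    have h1 := hK k hk
    have h2 := hVd k
    have h3 := min_le_right (ε / 2) (σ * δ ^ 2 / 8)
    have h4 := min_le_left (ε / 2) (σ * δ ^ 2 / 8)
    have h5 : d k < δ := by
      refine lt_of_pow_lt_pow_left₀ 2 hδ.le ?_
      have : σ * d k ^ 2 < σ * δ ^ 2 := by nlinarith [mul_pos hσ (pow_pos hδ 2)]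
      exact lt_of_mul_lt_mul_left this hσ.le
    have h6 := abs_lt.1 (hδ' k h5)
    linarith [h6.2]
  have backs : ∀ m : ℕ, ∀ ε > 0, ∃ ε' > 0, ∃ K, ∀ k ≥ K, ∀ j ≤ m,
      v - ε' ≤ F (k + j) → v - ε ≤ F k := by
    intro m
    induction m with
    | zero =>
      intro ε hε
      refine ⟨ε, hε, 0, fun k _ j hj h => ?_⟩
      obtain rfl : j = 0 := by omega
      simpa using h
    | succ m ih =>
      intro ε hε
      obtain ⟨ε₁, hε₁, K₁, h₁⟩ := back ε hε
      obtain ⟨ε₂, hε₂, K₂, h₂⟩ := ih ε₁ hε₁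
      refine ⟨min ε ε₂, lt_min hε hε₂, max K₁ K₂, fun k hk j hj h => ?_⟩
      have hk1 := le_of_max_le_left hk
      have hk2 := le_of_max_le_right hk
      cases j with
      | zero =>
        have := min_le_left ε ε₂
        simp only [add_zero] at h
        linarith
      | succ j =>
        refine h₁ k hk1 (h₂ (k + 1) (by omega) j (by omega) ?_)
        rw [show k + 1 + j = k + (j + 1) by ring]
        exact (sub_le_sub_left (min_le_right ε ε₂) v).trans h
  have hF : Tendsto F atTop (𝓝 v) := by
    rw [Metric.tendsto_atTop]
    intro ε hε
    obtain ⟨ε', hε', K, hK⟩ := backs M (ε / 2) (by positivity)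
    obtain ⟨K', hK'⟩ := eventually_atTop.1
      (hVv.eventually (gt_mem_nhds (lt_add_of_pos_right v hε)))
    refine ⟨max K K', fun k hk => ?_⟩
    obtain ⟨t, ht, hFt⟩ := Finset.exists_mem_eq_sup' (hne (k + M)) F
    have hFt' : v ≤ F t := by rw [← hFt]; exact hvV (k + M)
    rw [Finset.mem_Icc] at ht
    have h1 := hK k (le_of_max_le_left hk) (t - k) (by omega) (by
      rw [show k + (t - k) = t by omega]; linarith)
    have h2 := hK' k (le_of_max_le_right hk)
    have h3 := hFV k
    rw [Real.dist_eq, abs_lt]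
    constructor <;> linarith
  refine ⟨⟨v, hF⟩, ?_⟩
  have hlim : Tendsto (fun k => 2 / σ * (V k - F (k + 1))) atTop (𝓝 0) := by
    simpa using (hVv.sub (hF.comp (tendsto_add_atTop_nat 1))).const_mul (2 / σ)
  have hsq : Tendsto (fun k => d k ^ 2) atTop (𝓝 0) := by
    refine squeeze_zero (fun k => sq_nonneg _) (fun k => ?_) hlim
    have := hVd k
    rw [div_mul_eq_mul_div, le_div_iff₀ hσ]
    linarith
  have := hsq.sqrt
  simpa [Real.sqrt_sq (hd _)] using this

/-! ### Functions of finitely many independent random indices -/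

section Prefix

variable {n : ℕ} {Ω : Type*} {idx : ℕ → Ω → Fin n} {k : ℕ} {u : Ω → ℝ}

lemma exists_factor_of_determined
    (hu : ∀ ω ω', (∀ t < k, idx t ω = idx t ω') → u ω = u ω') :
    ∃ g : (Finset.range k → Fin n) → ℝ, u = g ∘ fun ω t => idx t ω := by
  have h : Function.FactorsThrough u (fun ω (t : Finset.range k) => idx t ω) := by
    intro ω ω' h
    exact hu ω ω' fun t ht => congrFun h ⟨t, Finset.mem_range.2 ht⟩
  exact (Function.factorsThrough_iff u).1 h

variable [MeasurableSpace Ω] {P : Measure Ω}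

/-- Any finite history can be continued by any index, since such events have positive
probability. -/
lemma exists_history_extension (hind : iIndepFun idx P)
    {p : Fin n → ℝ} (hp : ∀ i, 0 < p i) (hlaw : ∀ k i, P.real {ω | idx k ω = i} = p i)
    (k : ℕ) (i : Fin n) (ω : Ω) : ∃ ω', (∀ t < k, idx t ω' = idx t ω) ∧ idx k ω' = i := by
  set c : ℕ → Fin n := fun t => if t < k then idx t ω else i with hc
  have h := hind.measure_inter_preimage_eq_mul (Finset.range (k + 1)) (sets := fun t => {c t})
    fun t _ => measurableSet_singleton _
  have hpos : P (⋂ t ∈ Finset.range (k + 1), idx t ⁻¹' {c t}) ≠ 0 := by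
    rw [h]
    refine Finset.prod_ne_zero_iff.2 fun t _ h0 => (hp (c t)).ne' ?_
    rw [← hlaw t (c t), Measure.real]
    exact (ENNReal.toReal_eq_zero_iff _).2 (Or.inl h0)
  obtain ⟨ω', hω'⟩ := nonempty_of_measure_ne_zero hpos
  simp only [Set.mem_iInter, Finset.mem_range, Set.mem_preimage, Set.mem_singleton_iff] at hω'
  refine ⟨ω', fun t ht => ?_, ?_⟩
  · rw [hω' t (by omega), hc]
    simp [ht]
  · rw [hω' k (by omega), hc]
    simp

variable [IsProbabilityMeasure P]

/-- A random variable determined by finitely many indices takes finitely many values, hence is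
integrable. -/
lemma integrable_of_determined (hmeas : ∀ k, Measurable (idx k))
    (hu : ∀ ω ω', (∀ t < k, idx t ω = idx t ω') → u ω = u ω') : Integrable u P := by
  obtain ⟨g, rfl⟩ := exists_factor_of_determined hu
  have hm : Measurable fun ω (t : Finset.range k) => idx t ω :=
    measurable_pi_lambda _ fun t => hmeas t
  obtain ⟨C, hC⟩ := (Set.finite_range fun c => ‖g c‖).bddAbove
  exact Integrable.of_bound ((measurable_of_finite g).comp hm).aestronglyMeasurable C
    (Eventually.of_forall fun ω => hC ⟨_, rfl⟩)

/-- The index drawn at time `k` is independent of any variable `u` determined by the earlier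
draws, so if `w` coincides with `u` on the event `i_k = i`, then `p_i E[u] ≤ E[w]`. -/
lemma mul_integral_le_of_determined (hmeas : ∀ k, Measurable (idx k)) (hind : iIndepFun idx P)
    {i : Fin n} {q : ℝ} (hlaw : P.real {ω | idx k ω = i} = q)
    (hu : ∀ ω ω', (∀ t < k, idx t ω = idx t ω') → u ω = u ω')
    {w : Ω → ℝ} (hw : Integrable w P) (hw0 : ∀ ω, 0 ≤ w ω)
    (huw : ∀ ω, idx k ω = i → u ω = w ω) :
    q * ∫ ω, u ω ∂P ≤ ∫ ω, w ω ∂P := by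
  have hui := integrable_of_determined (P := P) hmeas hu
  have hset : MeasurableSet {ω | idx k ω = i} := hmeas k (measurableSet_singleton i)
  obtain ⟨g, hg⟩ := exists_factor_of_determined hu
  have hI : IndepFun ({ω | idx k ω = i}.indicator (1 : Ω → ℝ)) u P := by
    have h := hind.indepFun_finset {k} (Finset.range k) (by simp) hmeas
    have h' := h.comp (φ := fun c : ({k} : Finset ℕ) → Fin n =>
      if c ⟨k, by simp⟩ = i then (1 : ℝ) else 0) (measurable_of_finite _) (measurable_of_finite g)
    rw [hg]
    convert h' using 1
    ext ω
    simp [Set.indicator_apply]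
  have hmul := hI.integral_mul_eq_mul_integral
    ((measurable_const.indicator hset).aestronglyMeasurable) hui.aestronglyMeasurable
  rw [integral_indicator_one hset, hlaw] at hmul
  rw [← hmul]
  refine integral_mono_of_nonneg (Eventually.of_forall fun ω => ?_) hw
    (Eventually.of_forall fun ω => ?_)
  · by_cases h : idx k ω = i
    · simpa [Set.indicator_apply, h, huw ω h] using hw0 ω
    · simp [h]
  · by_cases h : idx k ω = i
    · simp [h, huw ω h]
    · simpa [Set.indicator_apply, h] using hw0 ω

end Prefix

/-! ### Behaviour of the method along each path -/

section Paths

variable {n : ℕ} {N : Fin n → ℕ} {f : BlockSpace N → ℝ}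
  {Ψ : ∀ i : Fin n, EuclideanSpace ℝ (Fin (N i)) → EReal} {L : Fin n → ℝ}
  {η σ θlo θhi : ℝ} {M : ℕ} {x0 : BlockSpace N} {Ω : Type*} {idx : ℕ → Ω → Fin n}
  {x : ℕ → Ω → BlockSpace N}

lemma IsRNBPG.objective_le (hx : IsRNBPG f Ψ η σ θlo θhi M x0 idx x) (hσ : 0 < σ) (k : ℕ) (ω : Ω) :
    objective f Ψ (x k ω) ≤ objective f Ψ x0 := by
  induction k using Nat.strong_induction_on with
  | _ k ih =>
    cases k with
    | zero => rw [hx.init]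
    | succ k =>
      obtain ⟨θ0, -, J, s, -, -, hacc, he⟩ := hx.step k ω
      rw [he]
      refine (hacc.trans (EReal.sub_le_sub le_rfl
        (EReal.coe_le_coe_iff.2 (by positivity : (0 : ℝ) ≤ _)))).trans ?_
      rw [EReal.coe_zero, sub_zero]
      refine Finset.sup_le fun t ht => ih t ?_
      rw [Finset.mem_Icc] at ht
      omega

lemma IsRNBPG.objective_ne_top (hx : IsRNBPG f Ψ η σ θlo θhi M x0 idx x) (hσ : 0 < σ)
    (hx0 : objective f Ψ x0 < ⊤) (k : ℕ) (ω : Ω) : objective f Ψ (x k ω) ≠ ⊤ :=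
  ((hx.objective_le hσ k ω).trans_lt hx0).ne

lemma IsRNBPG.exists_prox (hx : IsRNBPG f Ψ η σ θlo θhi M x0 idx x) (hb : ∀ i u, Ψ i u ≠ ⊥)
    (hf : Differentiable ℝ f) (hLip : BlockLipschitzGradient f L) (hL : ∀ i, 0 < L i)
    (hη : 1 < η) (hσ : 0 < σ) (hθlo : 0 < θlo) (hx0 : objective f Ψ x0 < ⊤) (k : ℕ) (ω : Ω) :
    ∃ θ s, 0 ≤ θ ∧ θ ≤ max θhi (η * (∑ i, L i + σ)) ∧ IsProxSolution f Ψ (x k ω) (idx k ω) θ s ∧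
      x (k + 1) ω = x k ω + blockEmbed (idx k ω) s ∧
      ∃ t ∈ Finset.Icc (k - M) k, (objective f Ψ (x (k + 1) ω)).toReal
        ≤ (objective f Ψ (x t ω)).toReal - σ / 2 * dist (x (k + 1) ω) (x k ω) ^ 2 := by
  have hfin := hx.objective_ne_top hσ hx0
  have hmem : k ∈ Finset.Icc (k - M) k := by simp
  obtain ⟨θ, s, h0, h1, h2, h3, h4⟩ := (hx.step k ω).exists_prox hb hf hLip hL hη hθlo
    (hfin k ω) (Finset.le_sup (f := fun t => objective f Ψ (x t ω)) hmem)
  refine ⟨θ, s, h0, h1, h2, h3, ?_⟩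
  obtain ⟨t, ht, he⟩ := Finset.exists_mem_eq_sup _ ⟨k, hmem⟩ fun t => objective f Ψ (x t ω)
  refine ⟨t, ht, ?_⟩
  have hd : dist (x (k + 1) ω) (x k ω) = ‖(blockEmbed (idx k ω) s : BlockSpace N)‖ := by
    rw [h3, dist_eq_norm, add_sub_cancel_left]
  rw [SufficientReduction, he, ← h3, ← hd, ← EReal.coe_toReal (hfin t ω) (objective_ne_bot hb _),
    ← EReal.coe_toReal (hfin (k + 1) ω) (objective_ne_bot hb _), ← EReal.coe_sub,
    EReal.coe_le_coe_iff] at h4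
  exact h4

/-- Along every path the objective values converge and the steps tend to zero. -/
lemma IsRNBPG.tendsto_path (hx : IsRNBPG f Ψ η σ θlo θhi M x0 idx x) (hb : ∀ i u, Ψ i u ≠ ⊥)
    (hf : Differentiable ℝ f) (hLip : BlockLipschitzGradient f L) (hL : ∀ i, 0 < L i)
    (hη : 1 < η) (hσ : 0 < σ) (hθlo : 0 < θlo) (hx0 : objective f Ψ x0 < ⊤)
    (hopt : (optSet (objective f Ψ)).Nonempty)
    (hunif : UniformContinuousOn (fun y => (objective f Ψ y).toReal) (levelSetS f Ψ L σ θlo x0))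
    (ω : Ω) :
    (∃ v, Tendsto (fun k => (objective f Ψ (x k ω)).toReal) atTop (𝓝 v)) ∧
      Tendsto (fun k => dist (x (k + 1) ω) (x k ω)) atTop (𝓝 0) := by
  have hfin := hx.objective_ne_top hσ hx0
  have hS : ∀ k, x k ω ∈ levelSetS f Ψ L σ θlo x0 := by
    intro k
    refine (hx.objective_le hσ k ω).trans ?_
    rw [← EReal.coe_toReal hx0.ne (objective_ne_bot hb x0), EReal.coe_le_coe_iff,
      EReal.toReal_coe, le_add_iff_nonneg_right]
    exact mul_nonneg (zero_le_one.trans (le_max_right _ _))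
      (sub_nonneg.2 (optVal_le hb hopt hx0.ne))
  refine nonmonotone_descent (M := M) hσ (fun k => optVal_le hb hopt (hfin k ω))
    (fun k => dist_nonneg) (fun k => ?_) fun ε hε => ?_
  · obtain ⟨θ, s, -, -, -, -, h⟩ := hx.exists_prox hb hf hLip hL hη hσ hθlo hx0 k ω
    exact h
  · obtain ⟨δ, hδ, h⟩ := Metric.uniformContinuousOn_iff.1 hunif ε hε
    refine ⟨δ, hδ, fun k hk => ?_⟩
    have := h _ (hS (k + 1)) _ (hS k) hk
    rwa [Real.dist_eq] at this

lemma IsRNBPG.dist_sq_le (hx : IsRNBPG f Ψ η σ θlo θhi M x0 idx x) (hb : ∀ i u, Ψ i u ≠ ⊥)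
    (hf : Differentiable ℝ f) (hLip : BlockLipschitzGradient f L) (hL : ∀ i, 0 < L i)
    (hη : 1 < η) (hσ : 0 < σ) (hθlo : 0 < θlo) (hx0 : objective f Ψ x0 < ⊤)
    (hopt : (optSet (objective f Ψ)).Nonempty) (k : ℕ) (ω : Ω) :
    dist (x (k + 1) ω) (x k ω) ^ 2
      ≤ 2 / σ * ((objective f Ψ x0).toReal - optVal (objective f Ψ)) := by
  have hfin := hx.objective_ne_top hσ hx0
  obtain ⟨θ, s, -, -, -, -, t, -, h⟩ := hx.exists_prox hb hf hLip hL hη hσ hθlo hx0 k ω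
  have h1 := optVal_le hb hopt (hfin (k + 1) ω)
  have h2 := EReal.toReal_le_toReal (hx.objective_le hσ t ω) (objective_ne_bot hb _) hx0.ne
  rw [div_mul_eq_mul_div, le_div_iff₀ hσ]
  linarith

end Paths

/-! ### Convergence in expectation and in probability -/

section Expectation

variable {n : ℕ} {N : Fin n → ℕ} {f : BlockSpace N → ℝ}
  {Ψ : ∀ i : Fin n, EuclideanSpace ℝ (Fin (N i)) → EReal} {L : Fin n → ℝ}
  {η σ θlo θhi : ℝ} {M : ℕ} {x0 : BlockSpace N} {Ω : Type*} {idx : ℕ → Ω → Fin n}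
  {x : ℕ → Ω → BlockSpace N}

lemma le_add_mul_infDist {E : Type*} [PseudoMetricSpace E] {s : Set E} (hs : s.Nonempty) {y : E}
    {g a b : ℝ} (hb : 0 ≤ b) (h : ∀ z ∈ s, g ≤ a + b * dist y z) :
    g ≤ a + b * Metric.infDist y s := by
  rcases hb.eq_or_lt with rfl | hb
  · obtain ⟨z, hz⟩ := hs
    simpa using h z hz
  · have : (g - a) / b ≤ Metric.infDist y s := by
      refine (Metric.le_infDist hs).2 fun z hz => ?_
      rw [div_le_iff₀ hb]
      linarith [h z hz]
    rw [div_le_iff₀ hb] at this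
    linarith

/-- A bound `g ≤ C` turns a bound that is linear in the (possibly large) quantity `δ` into one
whose coefficient of `δ` is as small as desired. -/
lemma le_add_mul_add_div_mul {g a b C δ R : ℝ} (ha : 0 ≤ a) (hb : 0 ≤ b) (hC : 0 ≤ C)
    (hδ : 0 ≤ δ) (hR : 0 < R) (hg : g ≤ C) (h : g ≤ a + b * δ) :
    g ≤ a + R * b + C / R * δ := by
  rcases le_total δ R with h1 | h1
  · have := mul_le_mul_of_nonneg_left h1 hb
    have : 0 ≤ C / R * δ := by positivity
    linarith
  · have h2 : C ≤ C / R * δ := by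
      rw [div_mul_eq_mul_div, le_div_iff₀ hR]
      exact mul_le_mul_of_nonneg_left h1 hC
    have : 0 ≤ R * b := by positivity
    linarith

/-- The expected optimality gap at `x^k`, in terms of the expected change over one iteration.
The scale `R > 0` is free. -/
lemma IsRNBPG.integral_gap_le [MeasurableSpace Ω] {P : Measure Ω} [IsProbabilityMeasure P]
    (hx : IsRNBPG f Ψ η σ θlo θhi M x0 idx x) (hb : ∀ i u, Ψ i u ≠ ⊥)
    (hf : Differentiable ℝ f) (hfc : ConvexOn ℝ Set.univ f)
    (hLip : BlockLipschitzGradient f L) (hΨ : ERealConvex (sepSum Ψ)) (hL : ∀ i, 0 < L i)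
    (hη : 1 < η) (hσ : 0 < σ) (hθlo : 0 < θlo) (hx0 : objective f Ψ x0 < ⊤)
    (hopt : (optSet (objective f Ψ)).Nonempty)
    {p : Fin n → ℝ} (hp : ∀ i, 0 < p i) (hmeas : ∀ k, Measurable (idx k))
    (hind : iIndepFun idx P) (hlaw : ∀ k i, P.real {ω | idx k ω = i} = p i)
    {R : ℝ} (hR : 0 < R) (k : ℕ) :
    ∫ ω, ((objective f Ψ (x k ω)).toReal - optVal (objective f Ψ)) ∂P
      ≤ ∑ i, (∫ ω, (|(objective f Ψ (x k ω)).toReal - (objective f Ψ (x (k + 1) ω)).toReal|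
            + L i / 2 * dist (x (k + 1) ω) (x k ω) ^ 2) ∂P) / p i
        + R * (max θhi (η * (∑ i, L i + σ))
            * ∑ i, (∫ ω, dist (x (k + 1) ω) (x k ω) ∂P) / p i)
        + ((objective f Ψ x0).toReal - optVal (objective f Ψ)) / R
            * ∫ ω, Metric.infDist (x k ω) (optSet (objective f Ψ)) ∂P := by
  set Θ := max θhi (η * (∑ i, L i + σ)) with hΘ
  set C := (objective f Ψ x0).toReal - optVal (objective f Ψ) with hC
  have hfin := hx.objective_ne_top hσ hx0
  have hC0 : 0 ≤ C := sub_nonneg.2 (optVal_le hb hopt hx0.ne)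
  have hη0 : 0 < η := one_pos.trans hη
  have hΘ0 : 0 ≤ Θ := le_max_of_le_right
    (mul_nonneg hη0.le (add_nonneg (Finset.sum_nonneg fun i _ => (hL i).le) hσ.le))
  -- `y i` is the iterate that would follow `x k` if the block `i` were drawn.
  choose τ hτ hτi using exists_history_extension hind hp hlaw k
  have hxτ : ∀ i ω, x k (τ i ω) = x k ω := fun i ω => hx.determined k _ _ (hτ i ω)
  set y : Fin n → Ω → BlockSpace N := fun i ω => x (k + 1) (τ i ω) with hy
  have hydet : ∀ i ω ω', (∀ t < k, idx t ω = idx t ω') → y i ω = y i ω' := by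
    intro i ω ω' h
    refine hx.determined (k + 1) _ _ fun t ht => ?_
    rcases Nat.lt_succ_iff_lt_or_eq.1 ht with h1 | rfl
    · rw [hτ i ω t h1, hτ i ω' t h1, h t h1]
    · rw [hτi, hτi]
  have hyi : ∀ i ω, idx k ω = i → y i ω = x (k + 1) ω := by
    intro i ω h
    refine hx.determined (k + 1) _ _ fun t ht => ?_
    rcases Nat.lt_succ_iff_lt_or_eq.1 ht with h1 | rfl
    · exact hτ i ω t h1
    · rw [hτi, h]
  have hprox : ∀ i ω, ∃ θ s, 0 ≤ θ ∧ θ ≤ Θ ∧ IsProxSolution f Ψ (x k ω) i θ s ∧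
      y i ω = x k ω + blockEmbed i s := by
    intro i ω
    obtain ⟨θ, s, h0, h1, h2, h3, -⟩ :=
      hx.exists_prox hb hf hLip hL hη hσ hθlo hx0 k (τ i ω)
    have hi := hτi i ω
    generalize idx k (τ i ω) = j at hi s h2 h3
    subst hi
    rw [hxτ] at h2 h3
    exact ⟨θ, s, h0, h1, h2, h3⟩
  set a : Fin n → Ω → ℝ := fun i ω =>
    |(objective f Ψ (x k ω)).toReal - (objective f Ψ (y i ω)).toReal|
      + L i / 2 * dist (y i ω) (x k ω) ^ 2 with ha
  set b : Fin n → Ω → ℝ := fun i ω => dist (y i ω) (x k ω) with hbdef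
  have ha0 : ∀ i ω, 0 ≤ a i ω := fun i ω => by
    have := (hL i).le
    positivity
  have hgap : ∀ ω, (objective f Ψ (x k ω)).toReal - optVal (objective f Ψ)
      ≤ ∑ i, a i ω + R * (Θ * ∑ i, b i ω)
        + C / R * Metric.infDist (x k ω) (optSet (objective f Ψ)) := by
    intro ω
    choose θ s h0 h1 h2 h3 using fun i => hprox i ω
    have hsn : ∀ i, ‖s i‖ = dist (y i ω) (x k ω) := fun i => by
      rw [h3, dist_eq_norm, add_sub_cancel_left, norm_blockEmbed]
    refine le_add_mul_add_div_mul (Finset.sum_nonneg fun i _ => ha0 i ω)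
      (mul_nonneg hΘ0 (Finset.sum_nonneg fun i _ => dist_nonneg)) hC0 Metric.infDist_nonneg hR
      (sub_le_sub_right (EReal.toReal_le_toReal (hx.objective_le hσ k ω)
        (objective_ne_bot hb _) hx0.ne) _)
      (le_add_mul_infDist hopt
        (mul_nonneg hΘ0 (Finset.sum_nonneg fun i _ => dist_nonneg)) fun z hz => ?_)
    have := optimality_gap_le hb hf hfc hLip hΨ (hfin k ω) h0 h1 h2 hz
    simpa only [← h3, hsn] using this
  have hxdet : ∀ ω ω', (∀ t < k, idx t ω = idx t ω') → x k ω = x k ω' := hx.determined k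
  have hadet : ∀ i ω ω', (∀ t < k, idx t ω = idx t ω') → a i ω = a i ω' := fun i ω ω' h => by
    simp only [ha, hxdet ω ω' h, hydet i ω ω' h]
  have hbdet : ∀ i ω ω', (∀ t < k, idx t ω = idx t ω') → b i ω = b i ω' := fun i ω ω' h => by
    simp only [hbdef, hxdet ω ω' h, hydet i ω ω' h]
  have hai : ∀ i, Integrable (a i) P := fun i => integrable_of_determined hmeas (hadet i)
  have hbi : ∀ i, Integrable (b i) P := fun i => integrable_of_determined hmeas (hbdet i)
  have hgi : Integrable (fun ω => (objective f Ψ (x k ω)).toReal - optVal (objective f Ψ)) P :=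
    integrable_of_determined (k := k) hmeas fun ω ω' h => by rw [hxdet ω ω' h]
  have hdi : Integrable (fun ω => Metric.infDist (x k ω) (optSet (objective f Ψ))) P :=
    integrable_of_determined (k := k) hmeas fun ω ω' h => by rw [hxdet ω ω' h]
  have hsa : Integrable (fun ω => ∑ i, a i ω) P := integrable_finsetSum _ fun i _ => hai i
  have hsb : Integrable (fun ω => ∑ i, b i ω) P := integrable_finsetSum _ fun i _ => hbi i
  have hsab : Integrable (fun ω => ∑ i, a i ω + R * (Θ * ∑ i, b i ω)) P :=
    hsa.add ((hsb.const_mul Θ).const_mul R)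
  -- Averaging over the draw of the index compares `y i` with the actual next iterate.
  have hxdet' := hx.determined (k + 1)
  have hIa : ∀ i, ∫ ω, a i ω ∂P
      ≤ (∫ ω, (|(objective f Ψ (x k ω)).toReal - (objective f Ψ (x (k + 1) ω)).toReal|
            + L i / 2 * dist (x (k + 1) ω) (x k ω) ^ 2) ∂P) / p i := by
    intro i
    rw [le_div_iff₀ (hp i), mul_comm]
    refine mul_integral_le_of_determined hmeas hind (hlaw k i) (hadet i)
      (integrable_of_determined (k := k + 1) hmeas fun ω ω' h => ?_) (fun ω => ?_)
      fun ω h => ?_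
    · rw [hxdet' ω ω' h, hxdet ω ω' fun t ht => h t (ht.trans (Nat.lt_succ_self k))]
    · have := (hL i).le
      positivity
    · simp only [ha, hyi i ω h]
  have hIb : ∀ i, ∫ ω, b i ω ∂P ≤ (∫ ω, dist (x (k + 1) ω) (x k ω) ∂P) / p i := by
    intro i
    rw [le_div_iff₀ (hp i), mul_comm]
    refine mul_integral_le_of_determined hmeas hind (hlaw k i) (hbdet i)
      (integrable_of_determined (k := k + 1) hmeas fun ω ω' h => ?_) (fun ω => dist_nonneg)
      fun ω h => ?_
    · rw [hxdet' ω ω' h, hxdet ω ω' fun t ht => h t (ht.trans (Nat.lt_succ_self k))]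
    · simp only [hbdef, hyi i ω h]
  calc _ ≤ ∫ ω, (∑ i, a i ω + R * (Θ * ∑ i, b i ω)
        + C / R * Metric.infDist (x k ω) (optSet (objective f Ψ))) ∂P :=
        integral_mono hgi (hsab.add (hdi.const_mul _)) hgap
    _ = ∑ i, ∫ ω, a i ω ∂P + R * (Θ * ∑ i, ∫ ω, b i ω ∂P)
        + C / R * ∫ ω, Metric.infDist (x k ω) (optSet (objective f Ψ)) ∂P := by
        rw [integral_add hsab (hdi.const_mul _),
          integral_add hsa ((hsb.const_mul Θ).const_mul R), integral_const_mul,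
          integral_const_mul, integral_const_mul, integral_finsetSum _ fun i _ => hai i,
          integral_finsetSum _ fun i _ => hbi i]
    _ ≤ _ := by
        refine add_le_add (add_le_add (Finset.sum_le_sum fun i _ => hIa i) ?_) le_rfl
        exact mul_le_mul_of_nonneg_left (mul_le_mul_of_nonneg_left
          (Finset.sum_le_sum fun i _ => hIb i) hΘ0) hR.le

/-- The expected optimality gap tends to zero. -/
lemma IsRNBPG.tendsto_integral_gap [MeasurableSpace Ω] {P : Measure Ω} [IsProbabilityMeasure P]
    (hx : IsRNBPG f Ψ η σ θlo θhi M x0 idx x) (hb : ∀ i u, Ψ i u ≠ ⊥)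
    (hf : Differentiable ℝ f) (hfc : ConvexOn ℝ Set.univ f)
    (hLip : BlockLipschitzGradient f L) (hΨ : ERealConvex (sepSum Ψ)) (hL : ∀ i, 0 < L i)
    (hη : 1 < η) (hσ : 0 < σ) (hθlo : 0 < θlo) (hx0 : objective f Ψ x0 < ⊤)
    (hopt : (optSet (objective f Ψ)).Nonempty)
    {p : Fin n → ℝ} (hp : ∀ i, 0 < p i) (hmeas : ∀ k, Measurable (idx k))
    (hind : iIndepFun idx P) (hlaw : ∀ k i, P.real {ω | idx k ω = i} = p i)
    (hunif : UniformContinuousOn (fun y => (objective f Ψ y).toReal) (levelSetS f Ψ L σ θlo x0))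
    (hbdd : ∃ φ : ℕ → ℕ, StrictMono φ ∧ BddAbove (Set.range fun k =>
      ∫ ω, Metric.infDist (x (φ k) ω) (optSet (objective f Ψ)) ∂P)) :
    Tendsto (fun k => ∫ ω, ((objective f Ψ (x k ω)).toReal - optVal (objective f Ψ)) ∂P)
      atTop (𝓝 0) := by
  set Fr : ℕ → Ω → ℝ := fun k ω => (objective f Ψ (x k ω)).toReal with hFr
  set C := (objective f Ψ x0).toReal - optVal (objective f Ψ) with hC
  have hfin := hx.objective_ne_top hσ hx0
  have hlo : ∀ k ω, optVal (objective f Ψ) ≤ Fr k ω := fun k ω => optVal_le hb hopt (hfin k ω)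
  have hhi : ∀ k ω, Fr k ω ≤ (objective f Ψ x0).toReal := fun k ω =>
    EReal.toReal_le_toReal (hx.objective_le hσ k ω) (objective_ne_bot hb _) hx0.ne
  have hC0 : 0 ≤ C := sub_nonneg.2 (optVal_le hb hopt hx0.ne)
  have hpath := hx.tendsto_path hb hf hLip hL hη hσ hθlo hx0 hopt hunif
  have hsq := hx.dist_sq_le hb hf hLip hL hη hσ hθlo hx0 hopt
  have hdet : ∀ k ω ω', (∀ t < k + 1, idx t ω = idx t ω') →
      x (k + 1) ω = x (k + 1) ω' ∧ x k ω = x k ω' := fun k ω ω' h =>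
    ⟨hx.determined _ _ _ h, hx.determined _ _ _ fun t ht => h t (ht.trans (Nat.lt_succ_self k))⟩
  -- Dominated convergence.
  choose v hv using fun ω => (hpath ω).1
  have hlim : Tendsto (fun k => ∫ ω, (Fr k ω - optVal (objective f Ψ)) ∂P) atTop
      (𝓝 (∫ ω, (v ω - optVal (objective f Ψ)) ∂P)) := by
    refine tendsto_integral_of_dominated_convergence (fun _ => C) (fun k => ?_)
      (integrable_const _) (fun k => Eventually.of_forall fun ω => ?_)
      (Eventually.of_forall fun ω => (hv ω).sub_const _)
    · exact (integrable_of_determined (k := k) hmeas fun ω ω' h => by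
        simp only [hFr, hx.determined k ω ω' h]).aestronglyMeasurable
    · rw [Real.norm_of_nonneg (sub_nonneg.2 (hlo k ω))]
      exact sub_le_sub_right (hhi k ω) _
  have hlima : ∀ i, Tendsto (fun k => ∫ ω, (|Fr k ω - Fr (k + 1) ω|
      + L i / 2 * dist (x (k + 1) ω) (x k ω) ^ 2) ∂P) atTop (𝓝 0) := by
    intro i
    have hLi := (hL i).le
    rw [← integral_zero Ω ℝ (μ := P)]
    refine tendsto_integral_of_dominated_convergence (fun _ => C + L i / 2 * (2 / σ * C))
      (fun k => ?_) (integrable_const _) (fun k => Eventually.of_forall fun ω => ?_)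
      (Eventually.of_forall fun ω => ?_)
    · exact (integrable_of_determined (k := k + 1) hmeas fun ω ω' h => by
        simp only [hFr, hdet k ω ω' h]).aestronglyMeasurable
    · rw [Real.norm_of_nonneg (by positivity)]
      refine add_le_add ?_ (mul_le_mul_of_nonneg_left (hsq k ω) (by positivity))
      rw [abs_le]
      constructor <;> linarith [hlo k ω, hhi k ω, hlo (k + 1) ω, hhi (k + 1) ω]
    · have h1 := ((hv ω).sub ((hv ω).comp (tendsto_add_atTop_nat 1))).abs
      have h2 := ((hpath ω).2.pow 2).const_mul (L i / 2)
      simpa using h1.add h2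
  have hlimb : Tendsto (fun k => ∫ ω, dist (x (k + 1) ω) (x k ω) ∂P) atTop (𝓝 0) := by
    rw [← integral_zero Ω ℝ (μ := P)]
    refine tendsto_integral_of_dominated_convergence (fun _ => √(2 / σ * C))
      (fun k => ?_) (integrable_const _) (fun k => Eventually.of_forall fun ω => ?_)
      (Eventually.of_forall fun ω => (hpath ω).2)
    · exact (integrable_of_determined (k := k + 1) hmeas fun ω ω' h => by
        simp only [hdet k ω ω' h]).aestronglyMeasurable
    · rw [Real.norm_of_nonneg dist_nonneg]
      exact Real.le_sqrt_of_sq_le (hsq k ω)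
  set m := ∫ ω, (v ω - optVal (objective f Ψ)) ∂P with hm
  obtain ⟨φ, hφ, B, hB⟩ := hbdd
  have hmR : ∀ R > 0, m ≤ C * B / R := by
    intro R hR
    have hr : Tendsto (fun k => ∑ i, (∫ ω, (|Fr k ω - Fr (k + 1) ω|
            + L i / 2 * dist (x (k + 1) ω) (x k ω) ^ 2) ∂P) / p i
        + R * (max θhi (η * (∑ i, L i + σ))
            * ∑ i, (∫ ω, dist (x (k + 1) ω) (x k ω) ∂P) / p i) + C / R * B) atTop
        (𝓝 (∑ i, 0 / p i + R * (max θhi (η * (∑ i, L i + σ)) * ∑ i, 0 / p i) + C / R * B)) :=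
      ((tendsto_finsetSum _ fun i _ => (hlima i).div_const (p i)).add
        (((tendsto_finsetSum _ fun i _ => hlimb.div_const (p i)).const_mul _).const_mul
          R)).add_const _
    have := le_of_tendsto_of_tendsto' (hlim.comp hφ.tendsto_atTop) (hr.comp hφ.tendsto_atTop)
      fun k => (hx.integral_gap_le hb hf hfc hLip hΨ hL hη hσ hθlo hx0 hopt hp hmeas hind hlaw
        hR (φ k)).trans (add_le_add le_rfl
          (mul_le_mul_of_nonneg_left (hB ⟨k, rfl⟩) (div_nonneg hC0 hR.le)))
    simpa [mul_div_right_comm] using this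
  have hm0 : m ≤ 0 := ge_of_tendsto (tendsto_const_nhds.div_atTop tendsto_id)
    ((eventually_gt_atTop 0).mono fun R hR => hmR R hR)
  have hm1 : 0 ≤ m := ge_of_tendsto' hlim fun k =>
    integral_nonneg fun ω => sub_nonneg.2 (hlo k ω)
  rwa [le_antisymm hm0 hm1] at hlim

end Expectation

theorem mainTheorem4 {n : ℕ} (N : Fin n → ℕ)
    (f : BlockSpace N → ℝ) (Ψ : ∀ i : Fin n, EuclideanSpace ℝ (Fin (N i)) → EReal)
    (L : Fin n → ℝ)
    (hf : Differentiable ℝ f) (hL : ∀ i, 0 < L i) (hLip : BlockLipschitzGradient f L)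
    (hΨbot : ∀ i u, Ψ i u ≠ ⊥)
    (hopt : (optSet (objective f Ψ)).Nonempty)
    (hfconv : ConvexOn ℝ Set.univ f) (hΨconv : ERealConvex (sepSum Ψ))
    (η σ θlo θhi : ℝ) (hη : 1 < η) (hσ : 0 < σ) (hθlo : 0 < θlo) (hθ : θlo ≤ θhi) (M : ℕ)
    (p : Fin n → ℝ) (hp0 : ∀ i, 0 < p i) (hp1 : ∀ i, p i < 1) (hpsum : ∑ i, p i = 1)
    (x0 : BlockSpace N) (hx0 : objective f Ψ x0 < ⊤)
    {Ω : Type*} [MeasurableSpace Ω] (P : Measure Ω) [IsProbabilityMeasure P]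
    (idx : ℕ → Ω → Fin n) (hidx_meas : ∀ k, Measurable (idx k)) (hidx_indep : iIndepFun idx P)
    (hidx_law : ∀ k i, P.real {ω | idx k ω = i} = p i)
    (x : ℕ → Ω → BlockSpace N) (hx : IsRNBPG f Ψ η σ θlo θhi M x0 idx x)
    (hunif : UniformContinuousOn (fun y => (objective f Ψ y).toReal) (levelSetS f Ψ L σ θlo x0))
    (hbdd : ∃ φ : ℕ → ℕ, StrictMono φ ∧ BddAbove (Set.range fun k =>
      ∫ ω, Metric.infDist (x (φ k) ω) (optSet (objective f Ψ)) ∂P)) :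
    (∀ k ω, objective f Ψ (x k ω) < ⊤) ∧
    (∀ k, Integrable (fun ω => (objective f Ψ (x k ω)).toReal) P) ∧
    Tendsto (fun k => ∫ ω, (objective f Ψ (x k ω)).toReal ∂P) atTop
      (𝓝 (optVal (objective f Ψ))) ∧
    ∀ ε : ℝ, 0 < ε → ∀ ρ ∈ Set.Ioo (0 : ℝ) 1, ∃ K : ℕ, ∀ k ≥ K,
      P.real {ω | objective f Ψ (x k ω) - (optVal (objective f Ψ) : EReal) ≤ (ε : EReal)}
        ≥ 1 - ρ := by
  have hfin := hx.objective_ne_top hσ hx0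
  have hlim := hx.tendsto_integral_gap hΨbot hf hfconv hLip hΨconv hL hη hσ hθlo hx0 hopt hp0
    hidx_meas hidx_indep hidx_law hunif hbdd
  have hint : ∀ k, Integrable (fun ω => (objective f Ψ (x k ω)).toReal) P := fun k =>
    integrable_of_determined (k := k) hidx_meas fun ω ω' h => by rw [hx.determined k ω ω' h]
  have hgap : ∀ k ω, 0 ≤ (objective f Ψ (x k ω)).toReal - optVal (objective f Ψ) := fun k ω =>
    sub_nonneg.2 (optVal_le hΨbot hopt (hfin k ω))
  refine ⟨fun k ω => (hfin k ω).lt_top, hint, ?_, fun ε hε ρ hρ => ?_⟩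
  · have h := hlim.add_const (optVal (objective f Ψ))
    rw [zero_add] at h
    refine h.congr fun k => ?_
    rw [integral_sub (hint k) (integrable_const _), integral_const, probReal_univ, one_smul,
      sub_add_cancel]
  · obtain ⟨K, hK⟩ := eventually_atTop.1 (hlim.eventually (gt_mem_nhds (mul_pos hε hρ.1)))
    refine ⟨K, fun k hk => ?_⟩
    have hset : {ω | objective f Ψ (x k ω) - (optVal (objective f Ψ) : EReal) ≤ (ε : EReal)}
        = {ω | (objective f Ψ (x k ω)).toReal - optVal (objective f Ψ) ≤ ε} := by
      ext ω
      rw [Set.mem_ofPred_eq, Set.mem_ofPred_eq,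
        ← EReal.coe_toReal (hfin k ω) (objective_ne_bot hΨbot _), ← EReal.coe_sub,
        EReal.coe_le_coe_iff, EReal.toReal_coe]
    rw [hset]
    -- Markov's inequality bounds the probability of a gap of at least `ε`, and the two events
    -- cover the whole space.
    have hmarkov := mul_meas_ge_le_integral_of_nonneg (Eventually.of_forall (hgap k))
      ((hint k).sub (integrable_const (optVal (objective f Ψ)))) ε
    have hlt : P.real {ω | ε ≤ (objective f Ψ (x k ω)).toReal - optVal (objective f Ψ)} < ρ :=
      lt_of_mul_lt_mul_left (hmarkov.trans_lt (hK k hk)) hε.le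
    have hcover : (1 : ℝ) ≤ P.real {ω | (objective f Ψ (x k ω)).toReal
        - optVal (objective f Ψ) ≤ ε}
        + P.real {ω | ε ≤ (objective f Ψ (x k ω)).toReal - optVal (objective f Ψ)} := by
      rw [← probReal_univ (μ := P)]
      refine le_trans (measureReal_mono fun ω _ => ?_) (measureReal_union_le _ _)
      exact le_total ((objective f Ψ (x k ω)).toReal - optVal (objective f Ψ)) ε
    linarith
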